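/- Let $p$ be a prime number and let $(R,\mathfrak m)$ be a (commutative Noetherian) Cohen--Macaulay local ring of characteristic $p$ and of Krull dimension $d>0$. For $n\ge 0$ let $f^n\colon R\to R$, $f^n(r)=r^{p^n}$, be the $n$-th iterate of the Frobenius endomorphism, let ${}^{f^n}\!R$ be $R$ regarded as an $R$-module by restriction of scalars along $f^n$, and for an $R$-module $M$ let $F^n(M)=M\otimes_R{}^{f^n}\!R$ be the base change of $M$ along $f^n$, regarded as an $R$-module through the target of $f^n$. For an ideal $I$, let $I^{[p^t]}$ be the ideal generated by the $p^t$-th powers of the elements of $I$, and put $$\kappa(R)=\inf\{t\ge 0 : \text{there is a system of parameters } \mathbf x \text{ of } R \text{ with } \mathfrak m^{[p^t]}\subseteq(\mathbf x)\}.$$ Let $M$ be a finitely generated $R$-module which has a rank, that is, $M\otimes_R Q$ is a free $Q$-module of finite rank, where $Q$ is the total ring of fractions of $R$. Suppose that for one integer $n\ge\kappa(R)$ one has $$\operatorname{Tor}^R_i(M,{}^{f^n}\!R)=0\quad\text{for all } i \text{ with } 1\le i\le d-\operatorname{depth}F^n(M)$$ (where $\operatorname{depth} 0=\infty$). Then $M$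 has finite projective dimension over $R$. -/

import Mathlib

universe u v

noncomputable section

namespace FrobeniusTor

open CategoryTheory

/-- The depth of a module over a local ring: the supremum of the lengths of the `M`-regular
sequences in the maximal ideal. For a nonzero finitely generated module, weak regularity of a
sequence in the maximal ideal is regularity, by Nakayama's lemma; the zero module gets depth `⊤`. -/
def depth (R : Type u) [CommRing R] [IsLocalRing R] (M : Type v) [AddCommGroup M] [Module R M] :
    ℕ∞ :=
  ⨆ (rs : List R) (_ : (∀ r ∈ rs, r ∈ IsLocalRing.maximalIdeal R) ∧
    RingTheory.Sequence.IsWeaklyRegular M rs), (rs.length : ℕ∞)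

/-- A Noetherian local ring is Cohen–Macaulay if its depth equals its Krull dimension. -/
def IsCohenMacaulayLocal (R : Type u) [CommRing R] [IsLocalRing R] : Prop :=
  IsNoetherianRing R ∧ ((depth R R : ℕ∞) : WithBot ℕ∞) = ringKrullDim R

/-- A (full) system of parameters of a Noetherian local ring: `dim R` elements which generate an
ideal with radical the maximal ideal. -/
def IsSystemOfParameters (R : Type u) [CommRing R] [IsLocalRing R] (xs : List R) : Prop :=
  (xs.length : WithBot ℕ∞) = ringKrullDim R ∧
    (Ideal.ofList xs).radical = IsLocalRing.maximalIdeal R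

/-- The Frobenius power `I^[p^t]`, the ideal generated by all `p^t`-th powers of elements of `I`. -/
def frobeniusPower {R : Type u} [CommRing R] (p : ℕ) [Fact p.Prime] [CharP R p]
    (I : Ideal R) (t : ℕ) : Ideal R :=
  I.map (iterateFrobenius R p t)

/-- The invariant `κ(R)`: the infimum of all `t` such that `m^[p^t] ⊆ (x)` for some system of
parameters `x` of `R`. -/
def kappa (R : Type u) [CommRing R] [IsLocalRing R] (p : ℕ) [Fact p.Prime] [CharP R p] : ℕ∞ :=
  ⨅ (t : ℕ) (_ : ∃ xs : List R, IsSystemOfParameters R xs ∧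
    frobeniusPower p (IsLocalRing.maximalIdeal R) t ≤ Ideal.ofList xs), (t : ℕ∞)

/-- `M` has a rank: `M ⊗ Q` is a free `Q`-module of some finite rank `r`, where `Q` is the total
ring of fractions of `R`. -/
def HasRank (R : Type u) [CommRing R] (M : Type v) [AddCommGroup M] [Module R M] : Prop :=
  ∃ r : ℕ, Nonempty (LocalizedModule (nonZeroDivisors R) M
    ≃ₗ[Localization (nonZeroDivisors R)] (Fin r → Localization (nonZeroDivisors R)))

/-- The `R`-module `R` with the structure restricted along the `n`-th iterate of Frobenius. -/
abbrev frobeniusRestrict (R : Type u) [CommRing R] (p : ℕ) [Fact p.Prime] [CharP R p] (n : ℕ) :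
    ModuleCat.{u} R :=
  (ModuleCat.restrictScalars (iterateFrobenius R p n)).obj (ModuleCat.of R R)

/-- The Frobenius functor `F^n(M)`: base change of `M` along the `n`-th iterate of Frobenius, with
the `R`-module structure coming from the target of that map. -/
abbrev frobeniusFunctor (R : Type u) [CommRing R] (p : ℕ) [Fact p.Prime] [CharP R p] (n : ℕ) :
    ModuleCat.{u} R ⥤ ModuleCat.{u} R :=
  ModuleCat.extendScalars (iterateFrobenius R p n)

end FrobeniusTor

end

/-! Let S be R as the target of the n-th Frobenius. As κ(R) ≤ n, some system of parameters `xs`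
satisfies mS ⊆ (xs), and `xs` is S-regular because R is Cohen–Macaulay. With G finite free,
induction on s, starting from max(0, d − depth F^n(M)), shows pd M ≤ s.

If s = 0, `xs` is regular on S ⊗ M. For a minimal cover π : G → M, the kernel K of S ⊗ π lies in
mS(S ⊗ G) ⊆ (xs)(S ⊗ G). Regularity gives K = (xs)K, so K = 0 by Nakayama
(`exists_bijective_baseChange`). Over the total fraction ring Q, Frobenius is onto on spectra, so Q
⊗ G and the projective module Q ⊗ M have equal ranks. The split surjection Q ⊗ π is thus bijective,
and π is injective since G embeds in Q ⊗ G (`injective_of_bijective_baseChange`). Hence M is free.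

If s > 0, pass to a syzygy N of M. The Tor groups shift down, and Tor₁ = 0 keeps 0 → S ⊗ N → S ⊗ G →
S ⊗ M → 0 exact, so the depth bound rises by one (`ExtVanishing.of_shortExact`). -/

noncomputable section

namespace FrobeniusTor

section

open CategoryTheory Abelian Limits IsLocalRing RingTheory.Sequence
open scoped Pointwise

/-! ### Depth via Ext, and regularity of parameters. -/

section Depth

variable {R : Type u} [CommRing R] [IsLocalRing R]

/-- The Ext groups from the residue field to `M` vanish in degrees less than `k`. For a finitely
generated module over a Noetherian local ring this says that the depth is at least `k`. -/
def ExtVanishing (R : Type u) [CommRing R] [IsLocalRing R] (M : Type u) [AddCommGroup M]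
    [Module R M] (k : ℕ) : Prop :=
  ∀ i < k, Subsingleton (Ext (ModuleCat.of R (ResidueField R)) (ModuleCat.of R M) i)

lemma support_residueField :
    Module.support R (ResidueField R) = PrimeSpectrum.zeroLocus (maximalIdeal R) := by
  have : Module.support R (R ⧸ maximalIdeal R) = PrimeSpectrum.zeroLocus (maximalIdeal R) := by
    rw [Module.support_eq_zeroLocus, Ideal.annihilator_quotient]
  exact this

lemma maximalIdeal_smul_lt_top (M : Type v) [AddCommGroup M] [Module R M] [Module.Finite R M]
    [Nontrivial M] : maximalIdeal R • (⊤ : Submodule R M) < ⊤ :=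
  lt_top_iff_ne_top.mpr fun h ↦ top_ne_bot
    (Submodule.eq_bot_of_le_smul_of_le_jacobson_bot _ _ Module.Finite.fg_top h.ge
      (maximalIdeal_le_jacobson _))

lemma ExtVanishing.of_le_depth [IsNoetherianRing R] {M : Type u} [AddCommGroup M] [Module R M]
    [Module.Finite R M] {k : ℕ} (h : (k : ℕ∞) ≤ depth R M) : ExtVanishing R M k := by
  intro i hi
  -- The zero module has depth `⊤` but no regular sequence in the strict sense, so it is treated
  -- apart.
  cases subsingleton_or_nontrivial M with
  | inl hM =>
    have hid : 𝟙 (ModuleCat.of R M) = 0 :=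
      (IsZero.iff_id_eq_zero _).mp (ModuleCat.isZero_of_subsingleton _)
    refine ⟨fun a b ↦ ?_⟩
    rw [← Ext.comp_mk₀_id a, ← Ext.comp_mk₀_id b, hid, Ext.mk₀_zero, Ext.comp_zero, Ext.comp_zero]
  | inr hM =>
    have hlt : (i : ℕ∞) < depth R M := lt_of_lt_of_le (by exact_mod_cast hi) h
    obtain ⟨rs, hrs⟩ := lt_iSup_iff.mp hlt
    obtain ⟨⟨hmem, hreg⟩, hlen⟩ := lt_iSup_iff.mp hrs
    exact ModuleCat.subsingleton_ext_of_exists_isRegular (maximalIdeal R)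
      (ModuleCat.of R (ResidueField R)) support_residueField.le (ModuleCat.of R M)
      (maximalIdeal_smul_lt_top M) rs hmem
      ((isRegular_iff_isWeaklyRegular_of_subset_maximalIdeal hmem).mpr hreg) i
      (by exact_mod_cast hlen)

/-- The depth lemma, from the long exact Ext sequence; in degree 0, Hom(k, X₁) embeds in Hom(k, X₂).
-/
lemma ExtVanishing.of_shortExact {S : ShortComplex (ModuleCat.{u} R)} (hS : S.ShortExact) {k : ℕ}
    (h₂ : ExtVanishing R S.X₂ (k + 1)) (h₃ : ExtVanishing R S.X₃ k) :
    ExtVanishing R S.X₁ (k + 1) := by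
  rintro (_ | i) hi
  · have h0 := h₂ 0 hi
    have e₂ := Ext.addEquiv₀ (X := ModuleCat.of R (ResidueField R)) (Y := S.X₂)
    have : Subsingleton (ModuleCat.of R (ResidueField R) ⟶ S.X₂) := e₂.symm.subsingleton
    have : Subsingleton (ModuleCat.of R (ResidueField R) ⟶ S.X₁) :=
      ⟨fun a b ↦ by
        have := hS.mono_f
        rw [← cancel_mono S.f]; exact Subsingleton.elim _ _⟩
    exact (Ext.addEquiv₀ (X := ModuleCat.of R (ResidueField R)) (Y := S.X₁)).subsingleton
  · have z3 := AddCommGrpCat.isZero_of_iff_subsingleton.mpr (h₃ i (by omega))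
    have z2 := AddCommGrpCat.isZero_of_iff_subsingleton.mpr (h₂ (i + 1) (by omega))
    exact AddCommGrpCat.subsingleton_of_isZero <| ShortComplex.Exact.isZero_of_both_zeros
      (Ext.covariant_sequence_exact₁' (ModuleCat.of R (ResidueField R)) hS i (i + 1) rfl)
      (z3.eq_zero_of_src _) (z2.eq_zero_of_tgt _)

lemma ExtVanishing.quotSMulTop {M : Type u} [AddCommGroup M] [Module R M] {k : ℕ}
    (h : ExtVanishing R M (k + 1)) {x : R} (hx : IsSMulRegular M x) :
    ExtVanishing R (QuotSMulTop x M) k := by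
  intro i hi
  have z1 := AddCommGrpCat.isZero_of_iff_subsingleton.mpr (h i (by omega))
  have z2 := AddCommGrpCat.isZero_of_iff_subsingleton.mpr (h (i + 1) (by omega))
  have hx' : IsSMulRegular (ModuleCat.of R M) x := hx
  exact AddCommGrpCat.subsingleton_of_isZero <| ShortComplex.Exact.isZero_of_both_zeros
    (Ext.covariant_sequence_exact₃' (ModuleCat.of R (ResidueField R))
      hx'.smulShortComplex_shortExact i (i + 1) rfl)
    (z1.eq_zero_of_src _) (z2.eq_zero_of_tgt _)

lemma ExtVanishing.mono {M : Type u} [AddCommGroup M] [Module R M] {k l : ℕ}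
    (h : ExtVanishing R M l) (hkl : k ≤ l) : ExtVanishing R M k :=
  fun i hi ↦ h i (by omega)

lemma ExtVanishing.exists_isSMulRegular [IsNoetherianRing R] {M : Type u} [AddCommGroup M]
    [Module R M] [Module.Finite R M] {k : ℕ} (h : ExtVanishing R M (k + 1)) :
    ∃ x ∈ maximalIdeal R, IsSMulRegular M x := by
  have : Subsingleton (ModuleCat.of R (ResidueField R) ⟶ ModuleCat.of R M) :=
    have := h 0 (by omega)
    Ext.addEquiv₀.symm.subsingleton
  have : Subsingleton (ResidueField R →ₗ[R] M) :=
    (ModuleCat.homAddEquiv (M := ModuleCat.of R (ResidueField R))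
      (N := ModuleCat.of R M)).symm.subsingleton
  obtain ⟨x, hx, hreg⟩ := IsSMulRegular.subsingleton_linearMap_iff.mp this
  refine ⟨x, ?_, hreg⟩
  rw [Module.mem_annihilator] at hx
  have := hx (1 : ResidueField R)
  rw [Algebra.smul_def, mul_one] at this
  exact (residue_eq_zero_iff x).mp this

/-- If `x` is regular on `M`, an associated prime of `M` is properly contained in an associated
prime of `M/xM`. -/
lemma exists_lt_isAssociatedPrime_quotSMulTop [IsNoetherianRing R] {M : Type u} [AddCommGroup M]
    [Module R M] [Module.Finite R M] {x : R} (hx : IsSMulRegular M x) (hxm : x ∈ maximalIdeal R)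
    {P : Ideal R} (hP : IsAssociatedPrime P M) :
    ∃ Q : Ideal R, IsAssociatedPrime Q (QuotSMulTop x M) ∧ P < Q := by
  have hxP : x ∉ P := fun hxP ↦ by
    have h1 : x ∈ ⋃ p ∈ associatedPrimes R M, (p : Set R) := Set.mem_biUnion hP hxP
    rw [biUnion_associatedPrimes_eq_compl_regular] at h1
    exact h1 hx
  -- Let U be the submodule killed by P. If U ⊆ xM, then U ⊆ xU as x is regular, so U = 0 by
  -- Nakayama. But P is the annihilator of an element, which must then be 0.
  obtain ⟨u, hu⟩ : ∃ u : M, (∀ a ∈ P, a • u = 0) ∧ u ∉ x • (⊤ : Submodule R M) := by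
    by_contra! hcon
    let U : Submodule R M := ⨅ a : P, LinearMap.ker (LinearMap.lsmul R M a)
    have hU : ∀ u, u ∈ U ↔ ∀ a ∈ P, a • u = 0 := fun u ↦ by simp [U]
    have hle : U ≤ maximalIdeal R • U := fun u hu ↦ by
      obtain ⟨w, -, rfl⟩ := (Submodule.mem_smul_pointwise_iff_exists _ _ _).mp
        (hcon u ((hU u).mp hu))
      refine Submodule.smul_mem_smul hxm ((hU w).mpr fun a ha ↦ ?_)
      have := (hU _).mp hu a ha
      rw [smul_comm] at this
      exact hx (by simpa using this)
    have hbot := Submodule.eq_bot_of_le_smul_of_le_jacobson_bot _ _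
      (IsNoetherian.noetherian U) hle (maximalIdeal_le_jacobson _)
    obtain ⟨hPp, w, hw⟩ := isAssociatedPrime_iff.mp hP
    have h1 : w ∈ U := (hU _).mpr fun a ha ↦ by
      rwa [hw, Submodule.mem_colon_singleton, Submodule.mem_bot] at ha
    rw [hbot, Submodule.mem_bot] at h1
    refine hPp.ne_top ((Ideal.eq_top_iff_one _).mpr ?_)
    rw [hw, Submodule.mem_colon_singleton, h1, smul_zero]
    exact Submodule.zero_mem _
  have hne : (Submodule.Quotient.mk u : QuotSMulTop x M) ≠ 0 := fun h ↦
    hu.2 ((Submodule.Quotient.mk_eq_zero _).mp h)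
  obtain ⟨Q, hQ, hle⟩ := exists_le_isAssociatedPrime_of_isNoetherianRing R _ hne
  refine ⟨Q, hQ, lt_of_le_of_ne (fun a ha ↦ hle ?_) fun h ↦ hxP (h ▸ hle ?_)⟩
  · rw [Submodule.mem_colon_singleton, ← Submodule.Quotient.mk_smul, hu.1 a ha]
    simp
  · rw [Submodule.mem_colon_singleton]
    exact (Submodule.mem_bot R).mpr (Module.mem_annihilator.mp (QuotSMulTop.mem_annihilator M x) _)

/-- The bound depth M ≤ dim R/P: dividing by a regular element lowers the Ext bound by one while P
moves to a strictly larger associated prime. -/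
lemma ExtVanishing.le_coheight [IsNoetherianRing R] {M : Type u} [AddCommGroup M]
    [Module R M] [Module.Finite R M] {k : ℕ} (h : ExtVanishing R M k)
    {P : Ideal R} (hP : IsAssociatedPrime P M) :
    (k : ℕ∞) ≤ Order.coheight (⟨P, hP.isPrime⟩ : PrimeSpectrum R) := by
  induction k generalizing M P with
  | zero => simp
  | succ k ih =>
    obtain ⟨x, hxm, hx⟩ := h.exists_isSMulRegular
    obtain ⟨Q, hQ, hPQ⟩ := exists_lt_isAssociatedPrime_quotSMulTop hx hxm hP
    have hlt : (⟨P, hP.isPrime⟩ : PrimeSpectrum R) < ⟨Q, hQ.isPrime⟩ := hPQ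
    have := add_le_add_left (ih (h.quotSMulTop hx) hQ) 1
    push_cast
    exact this.trans (Order.coheight_add_one_le hlt)

/-- Krull's height theorem in R/P, whose maximal ideal is minimal over the image of `xs`. -/
lemma coheight_le_length [IsNoetherianRing R] (P : PrimeSpectrum R) (xs : List R)
    (h : maximalIdeal R ≤ (P.asIdeal ⊔ Ideal.ofList xs).radical)
    (hxs : Ideal.ofList xs ≤ maximalIdeal R) :
    Order.coheight P ≤ xs.length := by
  classical
  have : Nontrivial (R ⧸ P.asIdeal) := Ideal.Quotient.nontrivial_iff.mpr P.2.ne_top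
  have : IsLocalRing (R ⧸ P.asIdeal) :=
    .of_surjective' (Ideal.Quotient.mk P.asIdeal) Ideal.Quotient.mk_surjective
  let s : Finset (R ⧸ P.asIdeal) := (xs.map (Ideal.Quotient.mk P.asIdeal)).toFinset
  have hs : s.card ≤ xs.length := (List.toFinset_card_le _).trans (by simp)
  have hmin : maximalIdeal (R ⧸ P.asIdeal) ∈
      (Ideal.span (s : Set (R ⧸ P.asIdeal))).minimalPrimes := by
    refine ⟨⟨inferInstance, Ideal.span_le.mpr fun y hy ↦ ?_⟩, fun J hJ _ ↦ ?_⟩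
    · obtain ⟨x, hx, rfl⟩ := List.mem_map.mp (List.mem_toFinset.mp hy)
      have hxm : x ∈ maximalIdeal R := hxs (Ideal.subset_span hx)
      refine (mem_maximalIdeal _).mpr fun hu ↦ ?_
      obtain ⟨a, ha⟩ := Ideal.Quotient.mk_surjective (hu.unit⁻¹ : (R ⧸ P.asIdeal)ˣ).1
      have h1 : Ideal.Quotient.mk P.asIdeal (x * a) = Ideal.Quotient.mk P.asIdeal 1 := by
        rw [map_mul, ha, map_one]; exact hu.mul_val_inv
      have h2 := le_maximalIdeal P.2.ne_top (Ideal.Quotient.eq.mp h1)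
      exact (Ideal.ne_top_iff_one _).mp (maximalIdeal.isMaximal R).ne_top
        ((Submodule.sub_mem_iff_right _
          (Ideal.mul_mem_right a _ hxm)).mp h2)
    · have := hJ.1
      have hcomap : P.asIdeal ⊔ Ideal.ofList xs ≤ J.comap (Ideal.Quotient.mk P.asIdeal) := by
        refine sup_le (fun a ha ↦ ?_) (Ideal.span_le.mpr fun x hx ↦ ?_)
        · rw [Ideal.mem_comap, Ideal.Quotient.eq_zero_iff_mem.mpr ha]
          exact J.zero_mem
        · exact hJ.2 (Ideal.subset_span (List.mem_toFinset.mpr (List.mem_map_of_mem hx)))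
      have hm := h.trans (Ideal.IsPrime.radical_le_iff inferInstance |>.mpr hcomap)
      intro y hy
      obtain ⟨a, rfl⟩ := Ideal.Quotient.mk_surjective y
      exact hm fun ha ↦ hy (ha.map _)
  have h1 := Ideal.height_le_card_of_mem_minimalPrimes_span_finset hmin
  have h2 : (Order.coheight P : WithBot ℕ∞) = ringKrullDim (R ⧸ P.asIdeal) := by
    rw [Order.coheight_eq_krullDim_Ici, ringKrullDim_quotient]
    congr 1
  rw [← maximalIdeal_height_eq_ringKrullDim, WithBot.coe_inj] at h2
  rw [h2]
  exact h1.trans (by exact_mod_cast hs)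

/-- If the depth of `M` is at least `k`, any `k` elements generating an ideal which is primary to
the maximal ideal modulo the annihilator of `M` form a weakly `M`-regular sequence. -/
lemma ExtVanishing.isWeaklyRegular [IsNoetherianRing R] {M : Type u} [AddCommGroup M]
    [Module R M] [Module.Finite R M] (xs : List R) (h : ExtVanishing R M xs.length)
    (hxs : Ideal.ofList xs ≤ maximalIdeal R)
    (hrad : maximalIdeal R ≤ (Module.annihilator R M ⊔ Ideal.ofList xs).radical) :
    IsWeaklyRegular M xs := by
  induction xs generalizing M with
  | nil => exact .nil R M
  | cons x xs ih =>
    rw [Ideal.ofList_cons] at hxs hrad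
    have hx : IsSMulRegular M x := by
      -- A zero divisor x lies in an associated prime P ⊇ Ann M. Then the tail `xs` alone is primary
      -- modulo P, so dim R/P is at most its length, one less than the depth bound requires.
      by_contra hx
      have h1 : x ∈ ⋃ p ∈ associatedPrimes R M, (p : Set R) := by
        rw [biUnion_associatedPrimes_eq_compl_regular]; exact hx
      obtain ⟨P, hP, hxP⟩ := Set.mem_iUnion₂.mp h1
      have hle := h.le_coheight hP
      have := hle.trans (coheight_le_length ⟨P, hP.isPrime⟩ xs (hrad.trans (Ideal.radical_mono ?_))
        (le_sup_right.trans hxs))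
      · simp only [List.length_cons] at this
        have : xs.length + 1 ≤ xs.length := by exact_mod_cast this
        omega
      · rw [← sup_assoc]
        refine sup_le_sup_right (sup_le
          (Submodule.annihilator_top.symm.le.trans (IsAssociatedPrime.annihilator_le hP)) ?_) _
        rwa [Ideal.span_singleton_le_iff_mem]
    refine .cons hx (ih (h.quotSMulTop hx) (le_sup_right.trans hxs)
      (hrad.trans (Ideal.radical_mono ?_)))
    rw [← sup_assoc]
    refine sup_le_sup_right (sup_le ?_ ?_) _
    · exact LinearMap.annihilator_le_of_surjective _ (Submodule.mkQ_surjective _)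
    · rw [Ideal.span_singleton_le_iff_mem]
      exact QuotSMulTop.mem_annihilator M x

/-- If `xs` is weakly regular on a quotient `M/K` and `K ⊆ (xs)M`, then `K = (xs)K`, so `K = 0`. -/
lemma eq_bot_of_le_ofList_smul_top {M : Type v} [AddCommGroup M] [Module R M]
    (K : Submodule R M) (hK : K.FG) (xs : List R) (hxs : Ideal.ofList xs ≤ maximalIdeal R)
    (hreg : IsWeaklyRegular (M ⧸ K) xs) (hle : K ≤ Ideal.ofList xs • (⊤ : Submodule R M)) :
    K = ⊥ := by
  refine Submodule.eq_bot_of_le_smul_of_le_jacobson_bot _ _ hK ?_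
    (hxs.trans (maximalIdeal_le_jacobson _))
  -- Applied to K → K → M → M/K with first map 0, this makes K/(xs)K → M/(xs)M injective.
  have hex := map_first_exact_on_four_term_right_exact_of_isSMulRegular_last (rs := xs)
    (f₁ := (0 : K →ₗ[R] K)) (f₂ := K.subtype) (f₃ := K.mkQ)
    (by rw [LinearMap.exact_iff]; simp) (by rw [LinearMap.exact_iff]; simp)
    K.mkQ_surjective hreg
  intro k hk
  have h0 := (hex (Submodule.Quotient.mk ⟨k, hk⟩)).mp
    ((Submodule.Quotient.mk_eq_zero _).mpr (hle hk))
  obtain ⟨y, hy⟩ := h0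
  obtain ⟨y, rfl⟩ := Submodule.Quotient.mk_surjective _ y
  have h1 : (⟨k, hk⟩ : K) ∈ Ideal.ofList xs • (⊤ : Submodule R K) := by
    rw [← Submodule.Quotient.mk_eq_zero, ← hy]; rfl
  have := Submodule.mem_map_of_mem (f := K.subtype) h1
  rwa [Submodule.map_smul'', Submodule.map_top, Submodule.range_subtype] at this

end Depth

end

section

open CategoryTheory Limits TensorProduct MonoidalCategory

/-! ### Dimension shifting for Tor in the first variable. -/

section Tor

variable {R : Type u} [CommRing R]

lemma lTensor_rTensor_comm_apply {X Y X' Y' : Type*} [AddCommGroup X] [AddCommGroup Y]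
    [AddCommGroup X'] [AddCommGroup Y'] [Module R X] [Module R Y] [Module R X'] [Module R Y']
    (a : X →ₗ[R] X') (b : Y →ₗ[R] Y') (z : X ⊗[R] Y) :
    b.lTensor X' (a.rTensor Y z) = a.rTensor Y' (b.lTensor X z) := by
  rw [← LinearMap.comp_apply, ← LinearMap.comp_apply, LinearMap.lTensor_comp_rTensor,
    LinearMap.rTensor_comp_lTensor]

/-- The diagram chase behind dimension shifting for `Tor` in the first variable. -/
lemma exists_lTensor_eq_of_lTensor_rTensor_eq_zero {N G M A₂ A₁ A₀ B : Type*}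
    [AddCommGroup N] [AddCommGroup G] [AddCommGroup M] [AddCommGroup A₂] [AddCommGroup A₁]
    [AddCommGroup A₀] [AddCommGroup B] [Module R N] [Module R G] [Module R M] [Module R A₂]
    [Module R A₁] [Module R A₀] [Module R B] [Module.Flat R A₀]
    {f : N →ₗ[R] G} {g : G →ₗ[R] M} (hf : Function.Injective f) (hfg : Function.Exact f g)
    (hg : Function.Surjective g) {d₂ : A₂ →ₗ[R] A₁} {d₁ : A₁ →ₗ[R] A₀} {d₀ : A₀ →ₗ[R] B}
    (hd : d₁ ∘ₗ d₂ = 0) (hG : Function.Exact (d₁.lTensor G) (d₀.lTensor G))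
    (hM : Function.Exact (d₂.lTensor M) (d₁.lTensor M)) (n₀ : N ⊗[R] A₀)
    (hn₀ : d₀.lTensor G (f.rTensor A₀ n₀) = 0) : ∃ n₁, d₁.lTensor N n₁ = n₀ := by
  obtain ⟨g₁, hg₁⟩ := (hG _).mp hn₀
  have hm₁ : d₁.lTensor M (g.rTensor A₁ g₁) = 0 := by
    rw [lTensor_rTensor_comm_apply, hg₁, ← LinearMap.comp_apply, ← LinearMap.rTensor_comp,
      hfg.linearMap_comp_eq_zero]
    simp
  obtain ⟨m₂, hm₂⟩ := (hM _).mp hm₁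
  obtain ⟨g₂, rfl⟩ := LinearMap.rTensor_surjective A₂ hg m₂
  rw [lTensor_rTensor_comm_apply] at hm₂
  have hker : g.rTensor A₁ (g₁ - d₂.lTensor G g₂) = 0 := by rw [map_sub, hm₂, sub_self]
  obtain ⟨n₁, hn₁⟩ := (rTensor_exact A₁ hfg hg _).mp hker
  -- Flatness of A₀ allows the equality to be tested in G ⊗ A₀.
  refine ⟨n₁, Module.Flat.rTensor_preserves_injective_linearMap f hf ?_⟩
  rw [← lTensor_rTensor_comm_apply, hn₁, map_sub, hg₁, ← LinearMap.comp_apply,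
    ← LinearMap.lTensor_comp, hd]
  simp

/-- The group `Tor` in positive degree vanishes if and only if the tensor product with a
projective resolution is exact there. -/
lemma isZero_Tor_succ_iff (M Y : ModuleCat.{u} R) (P : ProjectiveResolution Y) (i : ℕ) :
    IsZero (((Tor (ModuleCat.{u} R) (i + 1)).obj M).obj Y) ↔
      Function.Exact ((P.complex.d (i + 2) (i + 1)).hom.lTensor M)
        ((P.complex.d (i + 1) i).hom.lTensor M) := by
  rw [Tor_obj, (P.isoLeftDerivedObj ((tensoringLeft _).obj M) (i + 1)).isZero_iff]
  change IsZero (HomologicalComplex.homology _ _) ↔ _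
  rw [← HomologicalComplex.exactAt_iff_isZero_homology,
    HomologicalComplex.exactAt_iff' _ (i + 2) (i + 1) i (by simp) (by simp),
    ShortComplex.ShortExact.moduleCat_exact_iff_function_exact]
  rfl

lemma exact_resolution_succ {Y : ModuleCat.{u} R} (P : ProjectiveResolution Y) (i : ℕ) :
    Function.Exact (P.complex.d (i + 2) (i + 1)).hom (P.complex.d (i + 1) i).hom := by
  have := (P.exact_succ i)
  rw [ShortComplex.ShortExact.moduleCat_exact_iff_function_exact] at this
  exact this

lemma exact_resolution_zero {Y : ModuleCat.{u} R} (P : ProjectiveResolution Y) :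
    Function.Exact (P.complex.d 1 0).hom (P.π.f 0).hom := by
  have := P.exact₀
  rw [ShortComplex.ShortExact.moduleCat_exact_iff_function_exact] at this
  exact this

instance flat_resolution {Y : ModuleCat.{u} R} (P : ProjectiveResolution Y) (i : ℕ) :
    Module.Flat R (P.complex.X i) := by
  have : Module.Projective R (P.complex.X i) :=
    (IsProjective.iff_projective (P.complex.X i)).mpr (P.projective i)
  infer_instance

lemma d_comp_d_resolution {Y : ModuleCat.{u} R} (P : ProjectiveResolution Y) (i : ℕ) :
    (P.complex.d (i + 1) i).hom ∘ₗ (P.complex.d (i + 2) (i + 1)).hom = 0 :=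
  (exact_resolution_succ P i).linearMap_comp_eq_zero

section Shift

variable {N G M : Type u} [AddCommGroup N] [AddCommGroup G] [AddCommGroup M] [Module R N]
  [Module R G] [Module R M] [Module.Flat R G] {f : N →ₗ[R] G} {g : G →ₗ[R] M}

lemma isZero_Tor_succ_of_isZero_Tor_succ_succ (hf : Function.Injective f)
    (hfg : Function.Exact f g) (hg : Function.Surjective g) (Y : ModuleCat.{u} R) (i : ℕ)
    (h : IsZero (((Tor (ModuleCat.{u} R) (i + 2)).obj (ModuleCat.of R M)).obj Y)) :
    IsZero (((Tor (ModuleCat.{u} R) (i + 1)).obj (ModuleCat.of R N)).obj Y) := by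
  let P := projectiveResolution Y
  rw [isZero_Tor_succ_iff _ _ P] at h ⊢
  intro n₀
  constructor
  · intro hn₀
    refine exists_lTensor_eq_of_lTensor_rTensor_eq_zero hf hfg hg (d_comp_d_resolution P (i + 1))
      (Module.Flat.lTensor_exact G (exact_resolution_succ P i)) h n₀ ?_
    rw [lTensor_rTensor_comm_apply, hn₀, map_zero]
  · rintro ⟨n₁, rfl⟩
    rw [← LinearMap.comp_apply, ← LinearMap.lTensor_comp, d_comp_d_resolution,
      LinearMap.lTensor_zero, LinearMap.zero_apply]

lemma rTensor_injective_of_isZero_Tor_one (hf : Function.Injective f)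
    (hfg : Function.Exact f g) (hg : Function.Surjective g) (Y : ModuleCat.{u} R)
    (h : IsZero (((Tor (ModuleCat.{u} R) 1).obj (ModuleCat.of R M)).obj Y)) :
    Function.Injective (f.rTensor Y) := by
  let P := projectiveResolution Y
  rw [isZero_Tor_succ_iff _ _ P] at h
  rw [injective_iff_map_eq_zero]
  intro n hn
  have hπ : Function.Surjective (P.π.f 0).hom := (ModuleCat.epi_iff_surjective _).mp inferInstance
  obtain ⟨n₀, rfl⟩ := LinearMap.lTensor_surjective N hπ n
  obtain ⟨n₁, rfl⟩ := exists_lTensor_eq_of_lTensor_rTensor_eq_zero hf hfg hg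
    (d_comp_d_resolution P 0) (Module.Flat.lTensor_exact G (exact_resolution_zero P)) h n₀
    (by rw [lTensor_rTensor_comm_apply]; exact hn)
  have hz : (P.π.f 0).hom ∘ₗ (P.complex.d (0 + 1) 0).hom = 0 :=
    (exact_resolution_zero P).linearMap_comp_eq_zero
  rw [← LinearMap.comp_apply, ← LinearMap.lTensor_comp, hz, LinearMap.lTensor_zero,
    LinearMap.zero_apply]
  rfl

end Shift

end Tor

end

section

open CategoryTheory Limits TensorProduct IsLocalRing RingTheory.Sequence

/-! ### Minimal presentations and their base change. -/

section Presentation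

/-- A finitely generated module over a local ring is the quotient of a finite free module by a
submodule of `m` times it. -/
lemma exists_minimal_surjective {R : Type u} [CommRing R] [IsLocalRing R] (M : Type v)
    [AddCommGroup M] [Module R M] [Module.Finite R M] :
    ∃ (n : ℕ) (π : (Fin n → R) →ₗ[R] M), Function.Surjective π ∧
      LinearMap.ker π ≤ maximalIdeal R • ⊤ := by
  let b := Module.finBasis (ResidueField R) (ResidueField R ⊗[R] M)
  have hsurj : Function.Surjective (TensorProduct.mk R (ResidueField R) M 1) :=
    TensorProduct.mk_surjective R M (ResidueField R) residue_surjective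
  choose m hm using fun i ↦ hsurj (b i)
  have hm' : ∀ i, (1 : ResidueField R) ⊗ₜ[R] m i = b i := hm
  refine ⟨_, Fintype.linearCombination R m, ?_, fun r hr ↦ ?_⟩
  · rw [← LinearMap.range_eq_top, Fintype.range_linearCombination]
    exact span_eq_top_of_tmul_eq_basis m b hm'
  · rw [LinearMap.mem_ker, Fintype.linearCombination_apply] at hr
    have h0 : ∑ i, residue R (r i) • b i = 0 := by
      have := congrArg (TensorProduct.mk R (ResidueField R) M 1) hr
      simp only [map_sum, map_smul, map_zero, hm] at this
      rw [← this]
      exact Finset.sum_congr rfl fun i _ ↦ algebraMap_smul (ResidueField R) (r i) (b i)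
    have h1 := Fintype.linearIndependent_iff.mp b.linearIndependent _ h0
    rw [pi_eq_sum_univ r]
    exact Submodule.sum_mem _ fun i _ ↦
      Submodule.smul_mem_smul ((residue_eq_zero_iff _).mp (h1 i)) trivial

/-- By right exactness the kernel is the image of S ⊗ ker π. -/
lemma ker_baseChange_le {R S : Type*} [CommRing R] [CommRing S] [Algebra R S] {G M : Type*}
    [AddCommGroup G] [AddCommGroup M] [Module R G] [Module R M] {π : G →ₗ[R] M}
    (hπ : Function.Surjective π) {I : Ideal R} (hI : LinearMap.ker π ≤ I • ⊤) :
    LinearMap.ker (π.baseChange S) ≤ I.map (algebraMap R S) • ⊤ := by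
  intro z hz
  have hex := lTensor_exact S (LinearMap.exact_subtype_ker_map π) hπ
  obtain ⟨w, rfl⟩ := (hex z).mp hz
  induction w with
  | zero => simp
  | add a b ha hb =>
    rw [map_add]
    exact add_mem (ha (by rw [LinearMap.mem_ker]; exact hex.apply_apply_eq_zero a))
      (hb (by rw [LinearMap.mem_ker]; exact hex.apply_apply_eq_zero b))
  | tmul s l =>
    rw [LinearMap.lTensor_tmul]
    refine Submodule.smul_induction_on (p := fun x ↦ s ⊗ₜ[R] x ∈ I.map (algebraMap R S) •
      (⊤ : Submodule S (S ⊗[R] G))) (hI l.2) (fun a ha v _ ↦ ?_) fun x y hx hy ↦ ?_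
    · rw [TensorProduct.tmul_smul, ← algebraMap_smul S a (s ⊗ₜ[R] v)]
      exact Submodule.smul_mem_smul (Ideal.mem_map_of_mem _ ha) trivial
    · rw [TensorProduct.tmul_add]
      exact add_mem hx hy

variable {R S : Type u} [CommRing R] [IsLocalRing R] [CommRing S] [IsLocalRing S]
  [IsNoetherianRing S] [Algebra R S]

/-- If the base change of `M` has maximal depth, and the maximal ideal of `R` extends into a
parameter ideal of `S`, then the base change of a minimal presentation of `M` is bijective. -/
lemma exists_bijective_baseChange {xs : List S} (hxs : Ideal.ofList xs ≤ maximalIdeal S)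
    (hrad : maximalIdeal S ≤ (Ideal.ofList xs).radical)
    (hm : (maximalIdeal R).map (algebraMap R S) ≤ Ideal.ofList xs)
    (M : Type u) [AddCommGroup M] [Module R M] [Module.Finite R M]
    (h : ExtVanishing S (S ⊗[R] M) xs.length) :
    ∃ (n : ℕ) (π : (Fin n → R) →ₗ[R] M), Function.Surjective π ∧
      Function.Bijective (π.baseChange S) := by
  obtain ⟨n, π, hπ, hker⟩ := exists_minimal_surjective (R := R) M
  have hsurj : Function.Surjective (π.baseChange S) := LinearMap.lTensor_surjective S hπ
  refine ⟨n, π, hπ, LinearMap.ker_eq_bot.mp ?_, hsurj⟩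
  refine eq_bot_of_le_ofList_smul_top _ (IsNoetherian.noetherian _) xs hxs ?_
    ((ker_baseChange_le hπ hker).trans (Submodule.smul_mono_left hm))
  rw [((π.baseChange S).quotKerEquivOfSurjective hsurj).isWeaklyRegular_congr]
  exact h.isWeaklyRegular xs hxs (hrad.trans (Ideal.radical_mono le_sup_right))

end Presentation

/-! ### Rank comparison over the total fraction ring. -/

section Rank

variable {R S Q Q' : Type*} [CommRing R] [CommRing S] [CommRing Q] [CommRing Q'] [Algebra R S]
  [Algebra R Q] [Algebra R Q'] [Algebra S Q'] [Algebra Q Q'] [IsScalarTower R S Q']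
  [IsScalarTower R Q Q'] {G N M : Type*} [AddCommGroup G] [AddCommGroup N] [AddCommGroup M]
  [Module R G] [Module R N] [Module R M]

/-- Ranks are stable under base change, so they can be compared over Q', which receives the
isomorphism from S; every point of Spec Q comes from Spec Q'. -/
lemma rankAtStalk_eq_of_bijective_baseChange [Module.Finite R G] [Module.Finite R M]
    [Module.Flat Q (Q ⊗[R] M)]
    [Module.Flat R G] (hQ : Function.Surjective (PrimeSpectrum.comap (algebraMap Q Q')))
    (e : S ⊗[R] G ≃ₗ[S] S ⊗[R] M) :
    Module.rankAtStalk (R := Q) (Q ⊗[R] G) = Module.rankAtStalk (Q ⊗[R] M) := by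
  ext q
  obtain ⟨q', rfl⟩ := hQ q
  rw [← Module.rankAtStalk_baseChange, ← Module.rankAtStalk_baseChange]
  let e' : Q' ⊗[Q] (Q ⊗[R] G) ≃ₗ[Q'] Q' ⊗[Q] (Q ⊗[R] M) :=
    AlgebraTensorModule.cancelBaseChange R Q Q' Q' G ≪≫ₗ
      (AlgebraTensorModule.cancelBaseChange R S Q' Q' G).symm ≪≫ₗ
      e.baseChange S Q' _ _ ≪≫ₗ
      AlgebraTensorModule.cancelBaseChange R S Q' Q' M ≪≫ₗ
      (AlgebraTensorModule.cancelBaseChange R Q Q' Q' M).symm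
  rw [Module.rankAtStalk_eq_of_equiv e']

/-- A surjection from a finite projective module to a module which is projective over `Q` is
bijective if it becomes bijective over `S`. -/
lemma injective_of_bijective_baseChange [Module.Finite R G] [Module.Projective R G]
    [Module.Projective Q (Q ⊗[R] M)]
    (hQ : Function.Surjective (PrimeSpectrum.comap (algebraMap Q Q')))
    (hRQ : Function.Injective (algebraMap R Q)) {π : G →ₗ[R] M} (hπ : Function.Surjective π)
    (hbij : Function.Bijective (π.baseChange S)) : Function.Injective π := by
  have : Module.Finite R M := .of_surjective π hπ
  have hrank := rankAtStalk_eq_of_bijective_baseChange (Q := Q) hQ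
    (LinearEquiv.ofBijective (π.baseChange S) hbij)
  have hsurj : Function.Surjective (π.baseChange Q) := LinearMap.lTensor_surjective Q hπ
  obtain ⟨l, hl⟩ := Module.projective_lifting_property (π.baseChange Q) LinearMap.id hsurj
  -- Projectivity of Q ⊗ M splits off the kernel, which is then finite projective of rank 0, hence
  -- zero.
  obtain ⟨e, -, -⟩ := (LinearMap.exact_subtype_ker_map (π.baseChange Q)).splitSurjectiveEquiv
    (Submodule.subtype_injective _) ⟨l, hl⟩
  let K := LinearMap.ker (π.baseChange Q)
  have : Module.Projective Q K := .of_split (e.symm.toLinearMap ∘ₗ LinearMap.inl Q _ _)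
    (LinearMap.fst Q _ _ ∘ₗ e.toLinearMap) (by ext; simp)
  have : Module.Finite Q K := .of_surjective (LinearMap.fst Q _ _ ∘ₗ e.toLinearMap)
    (Prod.fst_surjective.comp e.surjective)
  rw [Module.rankAtStalk_eq_of_equiv (N := K × (Q ⊗[R] M)) e, Module.rankAtStalk_prod,
    add_eq_right, Module.rankAtStalk_eq_zero_iff_subsingleton] at hrank
  have hinj : Function.Injective (π.baseChange Q) :=
    LinearMap.ker_eq_bot.mp (Submodule.subsingleton_iff_eq_bot.mp hrank)
  have : FaithfulSMul R Q := (faithfulSMul_iff_algebraMap_injective R Q).mpr hRQ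
  have hG : Function.Injective (TensorProduct.mk R Q G 1) :=
    Module.Flat.tensorProduct_mk_injective R G Q
  refine Function.Injective.of_comp (f := TensorProduct.mk R Q M 1) ?_
  exact hinj.comp hG

lemma projective_baseChange_of_exact [Module.Flat R Q] [Module.Projective R G]
    [Module.Projective Q (Q ⊗[R] M)] {f : N →ₗ[R] G} {g : G →ₗ[R] M} (hf : Function.Injective f)
    (hfg : Function.Exact f g) (hg : Function.Surjective g) :
    Module.Projective Q (Q ⊗[R] N) := by
  have hsurj : Function.Surjective (g.baseChange Q) := LinearMap.lTensor_surjective Q hg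
  have hinj : Function.Injective (f.baseChange Q) :=
    Module.Flat.lTensor_preserves_injective_linearMap f hf
  have hex : Function.Exact (f.baseChange Q) (g.baseChange Q) := lTensor_exact Q hfg hg
  obtain ⟨l, hl⟩ := Module.projective_lifting_property (g.baseChange Q) LinearMap.id hsurj
  obtain ⟨e, -, -⟩ := hex.splitSurjectiveEquiv hinj ⟨l, hl⟩
  exact .of_split (e.symm.toLinearMap ∘ₗ LinearMap.inl Q _ _)
    (LinearMap.fst Q _ _ ∘ₗ e.toLinearMap) (by ext; simp)

end Rank

end

section

open CategoryTheory Limits TensorProduct IsLocalRing RingTheory.Sequence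

/-! ### Induction on the number of vanishing Tor groups. -/

section BaseChange

variable {R S Q Q' : Type u} [CommRing R] [IsLocalRing R] [IsNoetherianRing R] [CommRing S]
  [IsLocalRing S] [IsNoetherianRing S] [Algebra R S] [CommRing Q] [CommRing Q'] [Algebra R Q]
  [Algebra R Q'] [Algebra S Q'] [Algebra Q Q'] [IsScalarTower R S Q'] [IsScalarTower R Q Q']
  [Module.Flat R Q]

lemma ExtVanishing.of_isWeaklyRegular {xs : List S} (hxs : Ideal.ofList xs ≤ maximalIdeal S)
    {M : Type u} [AddCommGroup M] [Module S M] [Module.Finite S M] (h : IsWeaklyRegular M xs) :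
    ExtVanishing S M xs.length :=
  .of_le_depth (le_iSup₂_of_le xs ⟨fun _ hr ↦ hxs (Ideal.subset_span hr), h⟩ le_rfl)

/-- Let `R → S` be a homomorphism of Noetherian local rings such that the maximal ideal of `R`
extends into an ideal generated by a regular system of parameters of `S`. If `S ⊗ M` has
depth at least `dim S - s` and `Tor` vanishes in degrees `1, …, s`, then the projective dimension
of `M` is at most `s`, provided that `M` is projective over a suitable ring extension `Q`. -/
theorem hasProjectiveDimensionLT_of_isZero_Tor {xs : List S}
    (hxs : Ideal.ofList xs ≤ maximalIdeal S) (hrad : maximalIdeal S ≤ (Ideal.ofList xs).radical)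
    (hm : (maximalIdeal R).map (algebraMap R S) ≤ Ideal.ofList xs) (hS : IsWeaklyRegular S xs)
    (hQ : Function.Surjective (PrimeSpectrum.comap (algebraMap Q Q')))
    (hRQ : Function.Injective (algebraMap R Q)) (s : ℕ) (hs : s ≤ xs.length)
    (M : Type u) [AddCommGroup M] [Module R M] [Module.Finite R M]
    [Module.Projective Q (Q ⊗[R] M)] (hM : ExtVanishing S (S ⊗[R] M) (xs.length - s))
    (hTor : ∀ i < s, IsZero (((Tor (ModuleCat.{u} R) (i + 1)).obj (ModuleCat.of R M)).obj
      (ModuleCat.of R S))) :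
    HasProjectiveDimensionLT (ModuleCat.of R M) (s + 1) := by
  induction s generalizing M with
  | zero =>
    obtain ⟨n, π, hπ, hbij⟩ := exists_bijective_baseChange hxs hrad hm M hM
    have hinj : Function.Injective π := injective_of_bijective_baseChange (Q := Q) hQ hRQ hπ hbij
    have : Module.Projective R M := .of_equiv (LinearEquiv.ofBijective π ⟨hinj, hπ⟩)
    rw [zero_add, ← projective_iff_hasProjectiveDimensionLT_one]
    exact (IsProjective.iff_projective M).mp this
  | succ s ih =>
    obtain ⟨n, g, hg⟩ := Module.Finite.exists_fin' R M
    let N := LinearMap.ker g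
    have hf : Function.Injective N.subtype := N.subtype_injective
    have hfg : Function.Exact N.subtype g := g.exact_subtype_ker_map
    have hNQ : Module.Projective Q (Q ⊗[R] N) := projective_baseChange_of_exact hf hfg hg
    have hNTor : ∀ i < s, IsZero (((Tor (ModuleCat.{u} R) (i + 1)).obj (ModuleCat.of R N)).obj
        (ModuleCat.of R S)) := fun i hi ↦
      isZero_Tor_succ_of_isZero_Tor_succ_succ hf hfg hg _ i (hTor (i + 1) (by omega))
    have hinj : Function.Injective (N.subtype.baseChange S) :=
      (LinearMap.lTensor_inj_iff_rTensor_inj S N.subtype).mpr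
        (rTensor_injective_of_isZero_Tor_one hf hfg hg (ModuleCat.of R S) (hTor 0 (by omega)))
    have hex : Function.Exact (N.subtype.baseChange S) (g.baseChange S) := lTensor_exact S hfg hg
    have hsurj : Function.Surjective (g.baseChange S) := LinearMap.lTensor_surjective S hg
    let T : ShortComplex (ModuleCat.{u} S) := .mk (ModuleCat.ofHom (N.subtype.baseChange S))
      (ModuleCat.ofHom (g.baseChange S)) (ModuleCat.hom_ext hex.linearMap_comp_eq_zero)
    have hT : T.ShortExact :=
      { exact := (ShortComplex.ShortExact.moduleCat_exact_iff_function_exact T).mpr hex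
        mono_f := (ModuleCat.mono_iff_injective _).mpr hinj
        epi_g := (ModuleCat.epi_iff_surjective _).mpr hsurj }
    have hreg : IsWeaklyRegular (S ⊗[R] (Fin n → R)) xs :=
      ((TensorProduct.rid S (S ⊗[R] (Fin n → R))).isWeaklyRegular_congr xs).mp
        hS.isWeaklyRegular_lTensor
    have hG : ExtVanishing S (S ⊗[R] (Fin n → R)) xs.length := .of_isWeaklyRegular hxs hreg
    have hN : ExtVanishing S (S ⊗[R] N) (xs.length - s) := by
      obtain ⟨k, hk⟩ : ∃ k, xs.length = s + 1 + k := ⟨xs.length - (s + 1), by omega⟩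
      have hk₁ : xs.length - (s + 1) = k := by omega
      have hk₂ : xs.length - s = k + 1 := by omega
      rw [hk₁] at hM
      rw [hk₂]
      exact ExtVanishing.of_shortExact hT (hG.mono (by omega)) hM
    have hNpd := ih (by omega) N hN hNTor
    let T' : ShortComplex (ModuleCat.{u} R) := .mk (ModuleCat.ofHom N.subtype)
      (ModuleCat.ofHom g) (ModuleCat.hom_ext hfg.linearMap_comp_eq_zero)
    have hT' : T'.ShortExact :=
      { exact := (ShortComplex.ShortExact.moduleCat_exact_iff_function_exact T').mpr hfg
        mono_f := (ModuleCat.mono_iff_injective _).mpr hf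
        epi_g := (ModuleCat.epi_iff_surjective _).mpr hg }
    have hproj : Projective (ModuleCat.of R (Fin n → R)) :=
      (IsProjective.iff_projective _).mp inferInstance
    exact (hT'.hasProjectiveDimensionLT_X₃_iff s hproj).mpr hNpd

end BaseChange

/-! ### Specialization to Frobenius. -/

section Frobenius

variable (R : Type u) [CommRing R] (p : ℕ) [Fact p.Prime] [CharP R p] (n : ℕ)

/-- The ring `R`, regarded as the target of the `n`-th iterate of Frobenius. -/
def FrobeniusTarget (R : Type u) [CommRing R] (p : ℕ) [Fact p.Prime] [CharP R p] (_ : ℕ) :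
    Type u := R

instance : CommRing (FrobeniusTarget R p n) := inferInstanceAs (CommRing R)

instance [IsLocalRing R] : IsLocalRing (FrobeniusTarget R p n) := inferInstanceAs (IsLocalRing R)

instance [IsNoetherianRing R] : IsNoetherianRing (FrobeniusTarget R p n) :=
  inferInstanceAs (IsNoetherianRing R)

instance : Algebra R (FrobeniusTarget R p n) :=
  RingHom.toAlgebra (S := FrobeniusTarget R p n) (iterateFrobenius R p n)

/-- Frobenius acts as the identity on the spectrum: a prime contains a power of a exactly when it
contains a. -/
lemma comap_algebraMap_frobeniusTarget_surjective :
    Function.Surjective (PrimeSpectrum.comap (algebraMap R (FrobeniusTarget R p n))) := by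
  intro q
  refine ⟨(q : PrimeSpectrum R), PrimeSpectrum.ext (Ideal.ext fun a ↦ ?_)⟩
  have : iterateFrobenius R p n a = a ^ p ^ n := iterateFrobenius_def ..
  change iterateFrobenius R p n a ∈ q.asIdeal ↔ _
  rw [this]
  exact q.2.pow_mem_iff_mem _ (pow_pos (Fact.out : p.Prime).pos n)

lemma depth_frobeniusFunctor [IsLocalRing R] (M : Type u) [AddCommGroup M] [Module R M] :
    depth R ((frobeniusFunctor R p n).obj (ModuleCat.of R M)) =
      depth (FrobeniusTarget R p n) (FrobeniusTarget R p n ⊗[R] M) := rfl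

end Frobenius

lemma frobeniusPower_antitone {R : Type u} [CommRing R] (p : ℕ) [Fact p.Prime] [CharP R p]
    (I : Ideal R) {s t : ℕ} (hst : s ≤ t) : frobeniusPower p I t ≤ frobeniusPower p I s := by
  refine Ideal.map_le_iff_le_comap.mpr fun a ha ↦ ?_
  obtain ⟨k, rfl⟩ := Nat.exists_eq_add_of_le hst
  rw [Ideal.mem_comap, iterateFrobenius_def, pow_add, pow_mul]
  refine Ideal.pow_mem_of_mem _ ?_ _ (pow_pos (Fact.out : p.Prime).pos k)
  rw [← iterateFrobenius_def]
  exact Ideal.mem_map_of_mem _ ha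

lemma exists_systemOfParameters_of_kappa_le (R : Type u) [CommRing R] [IsLocalRing R] (p : ℕ)
    [Fact p.Prime] [CharP R p] {n : ℕ} (hn : kappa R p ≤ n) :
    ∃ xs : List R, IsSystemOfParameters R xs ∧
      frobeniusPower p (maximalIdeal R) n ≤ Ideal.ofList xs := by
  -- A strict bound extracts some t ≤ n from the infimum; Frobenius powers decrease in t.
  have hlt : kappa R p < (n + 1 : ℕ) := lt_of_le_of_lt hn (by exact_mod_cast n.lt_succ_self)
  obtain ⟨t, ht⟩ := iInf_lt_iff.mp hlt
  obtain ⟨⟨xs, hxs, hm⟩, htn⟩ := iInf_lt_iff.mp ht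
  have htn' : t < n + 1 := by exact_mod_cast htn
  exact ⟨xs, hxs, (frobeniusPower_antitone p _ (by omega)).trans hm⟩

lemma HasRank.projective {R : Type u} [CommRing R] {M : Type v} [AddCommGroup M] [Module R M]
    (h : HasRank R M) : Module.Projective (Localization (nonZeroDivisors R))
      (Localization (nonZeroDivisors R) ⊗[R] M) := by
  obtain ⟨r, ⟨e⟩⟩ := h
  exact .of_equiv (e.symm.trans (LocalizedModule.equivTensorProduct (nonZeroDivisors R) M))

end

end FrobeniusTor

end

open FrobeniusTor CategoryTheory in
theorem theorem2p8 {R : Type u} [CommRing R] [IsLocalRing R]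
    (p : ℕ) [Fact p.Prime] [CharP R p]
    (hCM : FrobeniusTor.IsCohenMacaulayLocal R)
    (d : ℕ) (hd : 0 < d) (hdim : ringKrullDim R = d)
    (M : Type u) [AddCommGroup M] [Module R M] [Module.Finite R M]
    (hM : FrobeniusTor.HasRank R M)
    (n : ℕ) (hn : FrobeniusTor.kappa R p ≤ n)
    (hTor : ∀ i : ℕ, 1 ≤ i →
      (i : ℕ∞) + FrobeniusTor.depth R
        ((FrobeniusTor.frobeniusFunctor R p n).obj (ModuleCat.of R M)) ≤ d →
      CategoryTheory.Limits.IsZero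
        (((CategoryTheory.Tor (ModuleCat.{u} R) i).obj (ModuleCat.of R M)).obj
          (FrobeniusTor.frobeniusRestrict R p n))) :
    CategoryTheory.projectiveDimension (ModuleCat.of R M) < ⊤ := by
  have : IsNoetherianRing R := hCM.1
  let S := FrobeniusTarget R p n
  let Q := Localization (nonZeroDivisors R)
  obtain ⟨xs, hlen, hxm, hrad, hm⟩ : ∃ xs : List S, xs.length = d ∧
      Ideal.ofList xs ≤ IsLocalRing.maximalIdeal S ∧
      IsLocalRing.maximalIdeal S ≤ (Ideal.ofList xs).radical ∧
      (IsLocalRing.maximalIdeal R).map (algebraMap R S) ≤ Ideal.ofList xs := by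
    obtain ⟨xs, hxs, hm⟩ := exists_systemOfParameters_of_kappa_le R p hn
    exact ⟨xs, by exact_mod_cast hxs.1.trans hdim, hxs.2 ▸ Ideal.le_radical, hxs.2.ge, hm⟩
  have hdepth : depth S S = d := by
    have : depth R R = d := by exact_mod_cast hCM.2.trans hdim
    exact this
  have hRQ : Function.Injective (algebraMap R Q) :=
    IsLocalization.injective Q (M := nonZeroDivisors R) le_rfl
  have : CharP Q p := charP_of_injective_algebraMap hRQ p
  let Q' := FrobeniusTarget Q p n
  -- The localization map between Frobenius targets; the square with R → Q commutes because ring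
  -- homomorphisms commute with Frobenius.
  let : Algebra S Q' := RingHom.toAlgebra (R := S) (S := Q') (algebraMap R Q)
  let : Algebra R Q' := ((algebraMap S Q').comp (algebraMap R S)).toAlgebra
  have : IsScalarTower R S Q' := .of_algebraMap_eq fun _ ↦ rfl
  have : IsScalarTower R Q Q' := .of_algebraMap_eq fun a ↦
    (algebraMap R Q).map_iterateFrobenius p a n
  have : Module.Flat R Q := IsLocalization.flat Q (nonZeroDivisors R)
  have : Module.Projective Q (TensorProduct R Q M) := hM.projective
  have hS : RingTheory.Sequence.IsWeaklyRegular S xs :=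
    ExtVanishing.isWeaklyRegular xs
      (.of_le_depth (by rw [hlen]; exact hdepth.ge)) hxm
      (hrad.trans (Ideal.radical_mono le_sup_right))
  rw [depth_frobeniusFunctor] at hTor
  -- Take s = d − depth F^n(M), or s = 0 if the depth is at least d, which includes F^n(M) = 0 with
  -- depth `⊤`.
  obtain ⟨s, hs, hsd, hsT⟩ : ∃ s : ℕ, s ≤ d ∧
      ((d - s : ℕ) : ℕ∞) ≤ depth S (TensorProduct R S M) ∧
      ∀ i < s, ((i + 1 : ℕ) : ℕ∞) + depth S (TensorProduct R S M) ≤ d := by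
    rcases le_or_gt (d : ℕ∞) (depth S (TensorProduct R S M)) with h | h
    · exact ⟨0, Nat.zero_le _, h, by simp⟩
    · obtain ⟨k, hk⟩ := ENat.ne_top_iff_exists.mp h.ne_top
      rw [← hk] at h ⊢
      have hkd : k < d := by exact_mod_cast h
      exact ⟨d - k, by omega, by norm_cast; omega, fun i hi ↦ by norm_cast; omega⟩
  have := hasProjectiveDimensionLT_of_isZero_Tor (S := S) (Q := Q) (Q' := Q') hxm hrad hm hS
    (comap_algebraMap_frobeniusTarget_surjective Q p n) hRQ s (by rwa [hlen]) M
    (.of_le_depth (by rwa [hlen])) fun i hi ↦ hTor (i + 1) (by omega) (hsT i hi)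
  exact ((projectiveDimension_ne_top_iff _).mpr ⟨s, this⟩).lt_top
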